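/- Consider the following game with parameter $\alpha\in[0,1]$. The bits $x_0,x_1,y,z\in\{0,1\}$ are independent and uniform; write $\vec x=(x_0,x_1)$. Alice, who receives $\vec x$, prepares a qubit state $\rho_{\vec x}$ and sends it to Bob. Bob, who receives $y$, applies a two-outcome qubit instrument $(\mathcal B^y_0,\mathcal B^y_1)$, i.e. a pair of completely positive maps on the operators on $\mathbb C^2$ whose sum is trace preserving, obtains an outcome $b$ and sends the resulting qubit to Charlie. Charlie, who receives $z$, performs a two-outcome POVM $(C^z_0,C^z_1)$ with outcome $c$. The three parties may share arbitrary classical randomness $\omega$ (a random variable independent of the inputs), on which all their operations may depend, so that $$p(b,c|\vec x,y,z)=\mathbb E_\omega\big[\mathrm{tr}\big(\mathcal B^{y,\omega}_b(\rho^\omega_{\vec x})\,C^{z,\omega}_c\big)\big].$$ The average success probability is $$\bar P_{\mathrm{succ}}=\frac{\alpha}{8}\sum_{\vec x,y}\Pr(b=x_y|\vec x,y)+\frac{1-\alpha}{8}\sum_{\vec x,z}\Pr(c=x_z|\vec x,z).$$ A two-outcome PVM is a POVM $(E_0,E_1)$ with $E_b^2=E_b$ (the trivial measurements $(\mathbb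 1,0)$ and $(0,\mathbb 1)$ included), and an instrument $(\mathcal B_0,\mathcal B_1)$ is compatible with it if $\mathrm{tr}(\rho E_b)=\mathrm{tr}(\mathcal B_b(\rho))$ for all states $\rho$ and $b=0,1$. Suppose that each instrument of Bob is compatible with a two-outcome PVM or is a probabilistic mixture (convex combination) of such instruments. Then $\bar P_{\mathrm{succ}}\le\bar P^{\mathrm{PVM}}_{\mathrm{succ}}(\alpha)$, where $$\bar P^{\mathrm{PVM}}_{\mathrm{succ}}(\alpha)=\begin{cases}\frac12+\frac{1-\alpha}{2\sqrt2}, & 0\le\alpha\le 1-\frac{2}{\sqrt7},\\[2pt] \frac12+\frac18\sqrt{4+(1-\alpha)^2}, & 1-\frac{2}{\sqrt7}<\alpha\le\frac13,\\[2pt] \frac12+\frac14\sqrt{1+\alpha^2}, & \frac13<\alpha\le 1.\end{cases}$$ -/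

import Mathlib

open scoped ComplexOrder
open MeasureTheory

namespace QubitPTM

/-- Linear operators on the qubit Hilbert space `ℂ²`, as matrices. -/
abbrev Op : Type := Matrix (Fin 2) (Fin 2) ℂ

/-- Density operators of a qubit. -/
def IsState (ρ : Op) : Prop :=
  ρ.PosSemidef ∧ ρ.trace = 1

/-- Two-outcome POVMs. -/
def IsPOVM (E : Fin 2 → Op) : Prop :=
  (∀ i, (E i).PosSemidef) ∧ E 0 + E 1 = 1

/-- Two-outcome projective measurements (PVMs): POVMs whose effects are projections.
The trivial measurements `(1, 0)` and `(0, 1)` are included. -/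
def IsPVM (E : Fin 2 → Op) : Prop :=
  IsPOVM E ∧ ∀ i, E i * E i = E i

/-- The map `id ⊗ Φ` on operators on `ℂᵏ ⊗ ℂ²`: apply `Φ` to every `2 × 2` block. -/
def amplify (k : ℕ) (Φ : Op →ₗ[ℂ] Op) (X : Matrix (Fin k × Fin 2) (Fin k × Fin 2) ℂ) :
    Matrix (Fin k × Fin 2) (Fin k × Fin 2) ℂ :=
  Matrix.of fun p q => Φ (Matrix.of fun a b => X (p.1, a) (q.1, b)) p.2 q.2

/-- Complete positivity: `id ⊗ Φ` preserves positive semidefiniteness for every ancilla. -/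
def IsCP (Φ : Op →ₗ[ℂ] Op) : Prop :=
  ∀ (k : ℕ) (X : Matrix (Fin k × Fin 2) (Fin k × Fin 2) ℂ),
    X.PosSemidef → (amplify k Φ X).PosSemidef

/-- Two-outcome qubit instruments: pairs of completely positive maps whose sum preserves the
trace (so that each map is trace nonincreasing). -/
def IsInstrument (I : Fin 2 → Op →ₗ[ℂ] Op) : Prop :=
  (∀ b, IsCP (I b)) ∧ ∀ X : Op, (I 0 X + I 1 X).trace = X.trace

/-- The instrument `I` realizes the measurement `E`: same outcome statistics on all states. -/
def Compatible (I : Fin 2 → Op →ₗ[ℂ] Op) (E : Fin 2 → Op) : Prop :=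
  ∀ ρ : Op, IsState ρ → ∀ b, (ρ * E b).trace = (I b ρ).trace

/-- Instruments that realize a projective measurement. -/
def pvmInstruments : Set (Fin 2 → Op →ₗ[ℂ] Op) :=
  {I | IsInstrument I ∧ ∃ E : Fin 2 → Op, IsPVM E ∧ Compatible I E}

/-- Instruments that realize a projective measurement, and probabilistic mixtures of them. -/
def pvmMixtures : Set (Fin 2 → Op →ₗ[ℂ] Op) :=
  convexHull ℝ pvmInstruments

/-- What the three parties do for a given value of the shared randomness: Alice's states `ρ x`
for `x = (x 0, x 1)`, Bob's instruments `B y` and Charlie's measurements `C z`. -/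
structure Strategy where
  /-- Alice's state for the input bits `x`. -/
  ρ : (Fin 2 → Fin 2) → Op
  /-- Bob's instrument for the input `y`; `B y b` is the map for the outcome `b`. -/
  B : Fin 2 → Fin 2 → Op →ₗ[ℂ] Op
  /-- Charlie's POVM for the input `z`; `C z c` is the effect for the outcome `c`. -/
  C : Fin 2 → Fin 2 → Op
  state : ∀ x, IsState (ρ x)
  instr : ∀ y, IsInstrument (B y)
  povm : ∀ z, IsPOVM (C z)

/-- The joint outcome distribution `p(b, c | x, y, z)` for a given value of the shared
randomness. -/
noncomputable def Strategy.prob (S : Strategy) (b c : Fin 2) (x : Fin 2 → Fin 2)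
    (y z : Fin 2) : ℝ :=
  ((S.B y b (S.ρ x) * S.C z c).trace).re

/-- The observed joint distribution `p(b, c | x, y, z)` when the shared randomness, independent
of the inputs, is distributed according to `μ`. -/
noncomputable def observedProb {Ω : Type*} [MeasurableSpace Ω] (μ : Measure Ω)
    (S : Ω → Strategy) (b c : Fin 2) (x : Fin 2 → Fin 2) (y z : Fin 2) : ℝ :=
  ∫ ω, (S ω).prob b c x y z ∂μ

/-- `Pr(b | x, y)` for uniform `z`. -/
noncomputable def bobProb (p : Fin 2 → Fin 2 → (Fin 2 → Fin 2) → Fin 2 → Fin 2 → ℝ)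
    (b : Fin 2) (x : Fin 2 → Fin 2) (y : Fin 2) : ℝ :=
  (1 / 2) * ∑ z : Fin 2, ∑ c : Fin 2, p b c x y z

/-- `Pr(c | x, z)` for uniform `y`. -/
noncomputable def charlieProb (p : Fin 2 → Fin 2 → (Fin 2 → Fin 2) → Fin 2 → Fin 2 → ℝ)
    (c : Fin 2) (x : Fin 2 → Fin 2) (z : Fin 2) : ℝ :=
  (1 / 2) * ∑ y : Fin 2, ∑ b : Fin 2, p b c x y z

/-- The average success probability for a joint distribution `p(b, c | x, y, z)`. -/
noncomputable def successProb (α : ℝ)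
    (p : Fin 2 → Fin 2 → (Fin 2 → Fin 2) → Fin 2 → Fin 2 → ℝ) : ℝ :=
  α / 8 * ∑ x : Fin 2 → Fin 2, ∑ y : Fin 2, bobProb p (x y) x y
    + (1 - α) / 8 * ∑ x : Fin 2 → Fin 2, ∑ z : Fin 2, charlieProb p (x z) x z

/-- The bound for projective strategies. -/
noncomputable def pvmBound (α : ℝ) : ℝ :=
  if α ≤ 1 - 2 / Real.sqrt 7 then 1 / 2 + (1 - α) / (2 * Real.sqrt 2)
  else if α ≤ 1 / 3 then 1 / 2 + 1 / 8 * Real.sqrt (4 + (1 - α) ^ 2)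
  else 1 / 2 + 1 / 4 * Real.sqrt (1 + α ^ 2)

end QubitPTM

/-! The success probability is affine in the shared randomness and linear in Bob's pair of
instruments, so it suffices to bound strategies whose instruments realize PVMs.

In Bloch coordinates a nontrivial PVM has a unit vector `n`. Each outcome never occurs on one pure
state, and positivity near that state makes the induced channel kill every direction orthogonal to
`n`. Its linear part is therefore `v ↦ ⟪n, v⟫ • δ` (`isBlochProjective_of_compatible`). A trivial
PVM has `n = 0`, and its channel is only known to be a contraction.

Charlie does not see `y`, so he faces `T = T₀ + T₁` with weight `β = (1 - α) / 2`. The score is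
linear in the differences of Alice's Bloch vectors. Its extremal directions `e`, `e'` are unit
vectors, so `e + e'` and `e - e'` are orthogonal, and Cauchy–Schwarz reduces the problem to
`scoreSq` on an orthogonal pair (`bloch_score_le`). Zero, one or two trivial measurements give the
bounds `1 + α²`, `1 + (1 - α)² / 4` and `2 (1 - α)²`; their maximum yields `pvmBound`
(`pvmBound_ge`). -/

namespace QubitPTM

/-! ### Optimization over Bloch vectors in a real inner product space. -/

section Vector

variable {V : Type*} [NormedAddCommGroup V] [InnerProductSpace ℝ V]

local notation "⟪" u ", " v "⟫" => inner ℝ u v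

/-- The Bloch picture of an instrument that realizes a projective measurement: `n` is the Bloch
vector of the observable and `T` the linear part of the induced channel. -/
def IsBlochProjective (n : V) (T : V →ₗ[ℝ] V) : Prop :=
  (‖n‖ ≤ 1 ∧ ∃ δ : V, ‖δ‖ ≤ 1 ∧ ∀ v, T v = ⟪n, v⟫ • δ) ∨ (n = 0 ∧ ∀ v, ‖T v‖ ≤ ‖v‖)

theorem abs_inner_le_of_norm_le_one {u v : V} (hu : ‖u‖ ≤ 1) : |⟪u, v⟫| ≤ ‖v‖ :=
  (abs_real_inner_le_norm u v).trans (by nlinarith [norm_nonneg v])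

/-- Bessel's inequality; `g` and `h` may be shorter than unit vectors, or zero. -/
theorem inner_sq_add_inner_sq_le {g h n : V} (hg : ‖g‖ ≤ 1) (hh : ‖h‖ ≤ 1) (hgh : ⟪g, h⟫ = 0)
    (hn : ‖n‖ ≤ 1) : ⟪g, n⟫ ^ 2 + ⟪h, n⟫ ^ 2 ≤ 1 := by
  have key : ‖n - (⟪g, n⟫ • g + ⟪h, n⟫ • h)‖ ^ 2 =
      ‖n‖ ^ 2 - 2 * (⟪g, n⟫ ^ 2 + ⟪h, n⟫ ^ 2) + ⟪g, n⟫ ^ 2 * ‖g‖ ^ 2 + ⟪h, n⟫ ^ 2 * ‖h‖ ^ 2 := by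
    rw [norm_sub_sq_real, norm_add_sq_real]
    simp only [inner_add_right, inner_smul_left, inner_smul_right, norm_smul, hgh, mul_pow,
      Real.norm_eq_abs, sq_abs, conj_trivial]
    rw [real_inner_comm g n, real_inner_comm h n]
    ring
  have h0 := sq_nonneg ‖n - (⟪g, n⟫ • g + ⟪h, n⟫ • h)‖
  have h1 : ‖g‖ ^ 2 ≤ 1 := by nlinarith [norm_nonneg g]
  have h2 : ‖h‖ ^ 2 ≤ 1 := by nlinarith [norm_nonneg h]
  have h3 : ‖n‖ ^ 2 ≤ 1 := by nlinarith [norm_nonneg n]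
  nlinarith [sq_nonneg ⟪g, n⟫, sq_nonneg ⟪h, n⟫]

/-- The squared optimal score for the directions `g`, `h` of Alice's preparations. -/
noncomputable def scoreSq (α β : ℝ) (n₀ n₁ : V) (T : V →ₗ[ℝ] V) (g h : V) : ℝ :=
  (α * |⟪g, n₀⟫| + β * ‖T g‖) ^ 2 + (α * |⟪h, n₁⟫| + β * ‖T h‖) ^ 2

/-- Two nontrivial measurements: `‖T v‖ ≤ |⟪v, n₀⟫| + |⟪v, n₁⟫|`. Cauchy–Schwarz with the
coefficients `(α + β, β)` in each summand, then Bessel for `n₀` and `n₁`, gives the constant. -/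
theorem scoreSq_le_of_both {α β : ℝ} (hα : 0 ≤ α) (hβ : 0 ≤ β) {n₀ n₁ δ₀ δ₁ g h : V}
    {T₀ T₁ : V →ₗ[ℝ] V} (hn₀ : ‖n₀‖ ≤ 1) (hn₁ : ‖n₁‖ ≤ 1) (hδ₀ : ‖δ₀‖ ≤ 1) (hδ₁ : ‖δ₁‖ ≤ 1)
    (hT₀ : ∀ v, T₀ v = ⟪n₀, v⟫ • δ₀) (hT₁ : ∀ v, T₁ v = ⟪n₁, v⟫ • δ₁)
    (hg : ‖g‖ ≤ 1) (hh : ‖h‖ ≤ 1) (hgh : ⟪g, h⟫ = 0) :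
    scoreSq α β n₀ n₁ (T₀ + T₁) g h ≤ 2 * ((α + β) ^ 2 + β ^ 2) := by
  have hT : ∀ v, ‖(T₀ + T₁) v‖ ≤ |⟪v, n₀⟫| + |⟪v, n₁⟫| := fun v => by
    rw [LinearMap.add_apply, hT₀, hT₁]
    refine (norm_add_le _ _).trans ?_
    rw [norm_smul, norm_smul, Real.norm_eq_abs, Real.norm_eq_abs, real_inner_comm n₀ v,
      real_inner_comm n₁ v]
    exact add_le_add (mul_le_of_le_one_right (abs_nonneg _) hδ₀)
      (mul_le_of_le_one_right (abs_nonneg _) hδ₁)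
  have b₀ := inner_sq_add_inner_sq_le hg hh hgh hn₀
  have b₁ := inner_sq_add_inner_sq_le hg hh hgh hn₁
  rw [← sq_abs ⟪g, n₀⟫, ← sq_abs ⟪h, n₀⟫] at b₀
  rw [← sq_abs ⟪g, n₁⟫, ← sq_abs ⟪h, n₁⟫] at b₁
  have cg : (α * |⟪g, n₀⟫| + β * ‖(T₀ + T₁) g‖) ^ 2 ≤
      ((α + β) * |⟪g, n₀⟫| + β * |⟪g, n₁⟫|) ^ 2 := by
    refine pow_le_pow_left₀ (by positivity) ?_ 2
    nlinarith [mul_le_mul_of_nonneg_left (hT g) hβ]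
  have ch : (α * |⟪h, n₁⟫| + β * ‖(T₀ + T₁) h‖) ^ 2 ≤
      ((α + β) * |⟪h, n₁⟫| + β * |⟪h, n₀⟫|) ^ 2 := by
    refine pow_le_pow_left₀ (by positivity) ?_ 2
    nlinarith [mul_le_mul_of_nonneg_left (hT h) hβ]
  unfold scoreSq
  generalize |⟪g, n₀⟫| = p₀ at *
  generalize |⟪g, n₁⟫| = p₁ at *
  generalize |⟪h, n₀⟫| = q₀ at *
  generalize |⟪h, n₁⟫| = q₁ at *
  have e := mul_le_mul_of_nonneg_left (add_le_add b₀ b₁)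
    (by positivity : 0 ≤ (α + β) ^ 2 + β ^ 2)
  nlinarith [sq_nonneg ((α + β) * p₁ - β * p₀), sq_nonneg ((α + β) * q₀ - β * q₁)]

theorem scoreSq_le_of_left {α β : ℝ} (hα : 0 ≤ α) (hβ : 0 ≤ β) {n₀ δ g h : V}
    {T₀ T₁ : V →ₗ[ℝ] V} (hn₀ : ‖n₀‖ ≤ 1) (hδ : ‖δ‖ ≤ 1) (hT₀ : ∀ v, T₀ v = ⟪n₀, v⟫ • δ)
    (hT₁ : ∀ v, ‖T₁ v‖ ≤ ‖v‖) (hg : ‖g‖ ≤ 1) (hh : ‖h‖ ≤ 1) (hgh : ⟪g, h⟫ = 0) :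
    scoreSq α β n₀ 0 (T₀ + T₁) g h ≤ (α + 2 * β) ^ 2 + β ^ 2 := by
  have hp : |⟪g, n₀⟫| ≤ 1 := (abs_inner_le_of_norm_le_one hg).trans hn₀
  have b := inner_sq_add_inner_sq_le hg hh hgh hn₀
  set p := ⟪g, n₀⟫ with hpdef
  set q := ⟪h, n₀⟫ with hqdef
  have hTg : (T₀ + T₁) g = p • δ + T₁ g := by
    rw [LinearMap.add_apply, hT₀, real_inner_comm]
  have hTh : (T₀ + T₁) h = q • δ + T₁ h := by
    rw [LinearMap.add_apply, hT₀, real_inner_comm]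
  have tg : ‖T₁ g‖ ≤ 1 := (hT₁ g).trans hg
  have th : ‖T₁ h‖ ≤ 1 := (hT₁ h).trans hh
  have hA : ‖(T₀ + T₁) g‖ ≤ 2 := by
    rw [hTg]
    refine (norm_add_le _ _).trans ?_
    rw [norm_smul, Real.norm_eq_abs]
    nlinarith [mul_le_mul hp hδ (norm_nonneg _) zero_le_one]
  have sqle : ∀ {x : ℝ}, 0 ≤ x → x ≤ 1 → x ^ 2 ≤ 1 := fun h0 h1 => by nlinarith
  have hcross : ⟪δ, T₁ (p • g + q • h)⟫ ≤ 1 := by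
    refine (real_inner_le_norm _ _).trans ?_
    have : ‖p • g + q • h‖ ^ 2 ≤ 1 := by
      rw [norm_add_sq_real, inner_smul_left, inner_smul_right, hgh, norm_smul, norm_smul, mul_pow,
        mul_pow, Real.norm_eq_abs, Real.norm_eq_abs, sq_abs, sq_abs]
      have := sqle (norm_nonneg g) hg
      have := sqle (norm_nonneg h) hh
      nlinarith [sq_nonneg p, sq_nonneg q]
    have h1 : ‖p • g + q • h‖ ≤ 1 := by nlinarith [norm_nonneg (p • g + q • h)]
    exact mul_le_one₀ hδ (norm_nonneg _) ((hT₁ _).trans h1)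
  -- The expansion consists of `(p² + q²) ‖δ‖² ≤ 1`, `‖T₁ g‖² + ‖T₁ h‖² ≤ 2` and twice the cross
  -- term `hcross`. The final bound is then `α² + 4αβ + 5β²`.
  have hAB : ‖(T₀ + T₁) g‖ ^ 2 + ‖(T₀ + T₁) h‖ ^ 2 ≤ 5 := by
    rw [hTg, hTh, norm_add_sq_real, norm_add_sq_real, norm_smul, norm_smul, mul_pow, mul_pow,
      inner_smul_left, inner_smul_left, Real.norm_eq_abs, Real.norm_eq_abs, sq_abs, sq_abs]
    rw [map_add, map_smul, map_smul, inner_add_right, inner_smul_right, inner_smul_right]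
      at hcross
    have d1 := sqle (norm_nonneg δ) hδ
    have d2 := sqle (norm_nonneg _) tg
    have d3 := sqle (norm_nonneg _) th
    simp only [conj_trivial]
    nlinarith [sq_nonneg p, sq_nonneg q]
  unfold scoreSq
  rw [inner_zero_right, abs_zero, mul_zero, zero_add, ← hpdef]
  have h1 : |p| * ‖(T₀ + T₁) g‖ ≤ 2 := by
    nlinarith [mul_le_mul hp hA (norm_nonneg _) zero_le_one]
  have h2 : |p| ^ 2 ≤ 1 := sqle (abs_nonneg p) hp
  nlinarith [mul_le_mul_of_nonneg_left h1 (mul_nonneg hα hβ),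
    mul_le_mul_of_nonneg_left h2 (sq_nonneg α), mul_le_mul_of_nonneg_left hAB (sq_nonneg β)]

theorem scoreSq_swap (α β : ℝ) (n₀ n₁ : V) (T : V →ₗ[ℝ] V) (g h : V) :
    scoreSq α β n₀ n₁ T g h = scoreSq α β n₁ n₀ T h g := add_comm _ _

theorem scoreSq_le_of_neither {α β : ℝ} (hβ : 0 ≤ β) {g h : V}
    {T₀ T₁ : V →ₗ[ℝ] V} (hT₀ : ∀ v, ‖T₀ v‖ ≤ ‖v‖) (hT₁ : ∀ v, ‖T₁ v‖ ≤ ‖v‖)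
    (hg : ‖g‖ ≤ 1) (hh : ‖h‖ ≤ 1) :
    scoreSq α β 0 0 (T₀ + T₁) g h ≤ 8 * β ^ 2 := by
  have hT : ∀ v, ‖v‖ ≤ 1 → (β * ‖(T₀ + T₁) v‖) ^ 2 ≤ (β * 2) ^ 2 := fun v hv => by
    refine pow_le_pow_left₀ (by positivity) (mul_le_mul_of_nonneg_left ?_ hβ) 2
    exact (norm_add_le _ _).trans (by linarith [hT₀ v, hT₁ v])
  simp only [scoreSq, inner_zero_right, abs_zero, mul_zero, zero_add]
  linarith [hT g hg, hT h hh]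

theorem scoreSq_le {α β C : ℝ} (hα : 0 ≤ α) (hβ : 0 ≤ β) {n₀ n₁ g h : V} {T₀ T₁ : V →ₗ[ℝ] V}
    (h₀ : IsBlochProjective n₀ T₀) (h₁ : IsBlochProjective n₁ T₁)
    (hg : ‖g‖ ≤ 1) (hh : ‖h‖ ≤ 1) (hgh : ⟪g, h⟫ = 0)
    (c₁ : 2 * ((α + β) ^ 2 + β ^ 2) ≤ C) (c₂ : (α + 2 * β) ^ 2 + β ^ 2 ≤ C)
    (c₃ : 8 * β ^ 2 ≤ C) : scoreSq α β n₀ n₁ (T₀ + T₁) g h ≤ C := by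
  rcases h₀ with ⟨hn₀, δ₀, hδ₀, hT₀⟩ | ⟨rfl, hT₀⟩ <;>
    rcases h₁ with ⟨hn₁, δ₁, hδ₁, hT₁⟩ | ⟨rfl, hT₁⟩
  · exact (scoreSq_le_of_both hα hβ hn₀ hn₁ hδ₀ hδ₁ hT₀ hT₁ hg hh hgh).trans c₁
  · exact (scoreSq_le_of_left hα hβ hn₀ hδ₀ hT₀ hT₁ hg hh hgh).trans c₂
  · rw [scoreSq_swap, add_comm T₀]
    exact (scoreSq_le_of_left hα hβ hn₁ hδ₁ hT₁ hT₀ hh hg (by rwa [real_inner_comm])).trans c₂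
  · exact (scoreSq_le_of_neither hβ hT₀ hT₁ hg hh).trans c₃

theorem exists_unit_le [Nontrivial V] (f : V →ₗ[ℝ] ℝ) {a : V} {r : ℝ} (ha : ‖a‖ ≤ r) :
    ∃ e : V, ‖e‖ = 1 ∧ f a ≤ r * f e := by
  have hr : 0 ≤ r := (norm_nonneg a).trans ha
  obtain ⟨u, hu, hau⟩ : ∃ u : V, ‖u‖ = 1 ∧ a = ‖a‖ • u := by
    by_cases h : a = 0
    · obtain ⟨u, hu⟩ := exists_norm_eq V zero_le_one
      exact ⟨u, hu, by simp [h]⟩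
    · exact ⟨‖a‖⁻¹ • a, norm_smul_inv_norm h, by
        rw [smul_smul, mul_inv_cancel₀ (norm_ne_zero_iff.2 h), one_smul]⟩
  have hf : f a = ‖a‖ * f u := by
    conv_lhs => rw [hau]
    rw [map_smul, smul_eq_mul]
  rcases le_total 0 (f u) with h | h
  · exact ⟨u, hu, hf ▸ mul_le_mul_of_nonneg_right ha h⟩
  · refine ⟨-u, by rwa [norm_neg], ?_⟩
    rw [hf, map_neg]
    nlinarith [norm_nonneg a]

/-- Sum and difference of unit vectors are orthogonal, and the parallelogram law gives `c² + s² =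
1`. If `e' = ±e`, one of `g`, `h` is zero, hence only norm bounds. -/
theorem exists_orthogonal_decomposition {e e' : V} (he : ‖e‖ = 1) (he' : ‖e'‖ = 1) :
    ∃ (g h : V) (c s : ℝ), ‖g‖ ≤ 1 ∧ ‖h‖ ≤ 1 ∧ ⟪g, h⟫ = 0 ∧ 0 ≤ c ∧ 0 ≤ s ∧
      c ^ 2 + s ^ 2 = 1 ∧ e + e' = (2 * c) • g ∧ e - e' = (2 * s) • h := by
  have hnorm : ∀ v : V, ‖‖v‖⁻¹ • v‖ ≤ 1 := fun v => by
    rw [norm_smul, norm_inv, norm_norm]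
    exact inv_mul_le_one
  have hself : ∀ v : V, v = (2 * (‖v‖ / 2)) • ‖v‖⁻¹ • v := fun v => by
    by_cases h : v = 0
    · simp [h]
    · rw [smul_smul, mul_div_cancel₀ _ (two_ne_zero), mul_inv_cancel₀ (norm_ne_zero_iff.2 h),
        one_smul]
  refine ⟨‖e + e'‖⁻¹ • (e + e'), ‖e - e'‖⁻¹ • (e - e'), ‖e + e'‖ / 2, ‖e - e'‖ / 2, hnorm _,
    hnorm _, ?_, by positivity, by positivity, ?_, hself _, hself _⟩
  · rw [inner_smul_left, inner_smul_right, (real_inner_add_sub_eq_zero_iff e e').2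
      (he.trans he'.symm), mul_zero, mul_zero]
  · have := parallelogram_law_with_norm ℝ e e'
    rw [he, he'] at this
    linarith

/-- The score of a strategy in the Bloch picture, for the differences `a = r₀₀ - r₁₁` and
`b = r₀₁ - r₁₀` of Alice's Bloch vectors. -/
theorem bloch_score_le [Nontrivial V] {α β C : ℝ} (hα : 0 ≤ α) (hβ : 0 ≤ β)
    {n₀ n₁ m₀ m₁ a b : V} {T₀ T₁ : V →ₗ[ℝ] V}
    (h₀ : IsBlochProjective n₀ T₀) (h₁ : IsBlochProjective n₁ T₁)
    (hm₀ : ‖m₀‖ ≤ 1) (hm₁ : ‖m₁‖ ≤ 1) (ha : ‖a‖ ≤ 2) (hb : ‖b‖ ≤ 2)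
    (c₁ : 2 * ((α + β) ^ 2 + β ^ 2) ≤ C) (c₂ : (α + 2 * β) ^ 2 + β ^ 2 ≤ C)
    (c₃ : 8 * β ^ 2 ≤ C) :
    α * (⟪n₀, a + b⟫ + ⟪n₁, a - b⟫) + β * (⟪m₀, (T₀ + T₁) (a + b)⟫ + ⟪m₁, (T₀ + T₁) (a - b)⟫)
      ≤ 4 * √C := by
  set T := T₀ + T₁ with hT
  let F₀ : V →ₗ[ℝ] ℝ := α • innerₛₗ ℝ n₀ + β • (innerₛₗ ℝ m₀ ∘ₗ T)
  let F₁ : V →ₗ[ℝ] ℝ := α • innerₛₗ ℝ n₁ + β • (innerₛₗ ℝ m₁ ∘ₗ T)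
  have hF₀ : ∀ v, F₀ v = α * ⟪n₀, v⟫ + β * ⟪m₀, T v⟫ := fun v => rfl
  have hF₁ : ∀ v, F₁ v = α * ⟪n₁, v⟫ + β * ⟪m₁, T v⟫ := fun v => rfl
  -- The objective is a linear functional of `a` plus one of `b`, so each can be moved separately to
  -- the sphere of radius 2.
  obtain ⟨e, he, hae⟩ := exists_unit_le (F₀ + F₁) ha
  obtain ⟨e', he', hbe⟩ := exists_unit_le (F₀ - F₁) hb
  obtain ⟨g, h, c, s, hg, hh, hgh, hc, hs, hcs, hG, hH⟩ := exists_orthogonal_decomposition he he'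
  have hlhs : α * (⟪n₀, a + b⟫ + ⟪n₁, a - b⟫) + β * (⟪m₀, T (a + b)⟫ + ⟪m₁, T (a - b)⟫) =
      (F₀ + F₁) a + (F₀ - F₁) b := by
    calc _ = F₀ (a + b) + F₁ (a - b) := by rw [hF₀, hF₁]; ring
      _ = _ := by
        rw [map_add F₀ a b, map_sub F₁ a b, LinearMap.add_apply F₀ F₁, LinearMap.sub_apply F₀ F₁]
        ring
  have hrhs : (F₀ + F₁) e + (F₀ - F₁) e' = 2 * (c * F₀ g + s * F₁ h) := by
    calc _ = F₀ (e + e') + F₁ (e - e') := by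
          rw [map_add F₀ e e', map_sub F₁ e e', LinearMap.add_apply F₀ F₁,
            LinearMap.sub_apply F₀ F₁]
          ring
      _ = _ := by rw [hG, hH, map_smul, map_smul, smul_eq_mul, smul_eq_mul]; ring
  have hx : F₀ g ≤ α * |⟪g, n₀⟫| + β * ‖T g‖ := by
    rw [hF₀, real_inner_comm]
    exact add_le_add (mul_le_mul_of_nonneg_left (le_abs_self _) hα)
      (mul_le_mul_of_nonneg_left ((le_abs_self _).trans (abs_inner_le_of_norm_le_one hm₀)) hβ)
  have hy : F₁ h ≤ α * |⟪h, n₁⟫| + β * ‖T h‖ := by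
    rw [hF₁, real_inner_comm]
    exact add_le_add (mul_le_mul_of_nonneg_left (le_abs_self _) hα)
      (mul_le_mul_of_nonneg_left ((le_abs_self _).trans (abs_inner_le_of_norm_le_one hm₁)) hβ)
  have hW := scoreSq_le hα hβ h₀ h₁ hg hh hgh c₁ c₂ c₃
  rw [← hT, scoreSq] at hW
  have hfin : c * F₀ g + s * F₁ h ≤ √C := by
    set X := α * |⟪g, n₀⟫| + β * ‖T g‖
    set Y := α * |⟪h, n₁⟫| + β * ‖T h‖
    calc c * F₀ g + s * F₁ h ≤ c * X + s * Y :=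
          add_le_add (mul_le_mul_of_nonneg_left hx hc) (mul_le_mul_of_nonneg_left hy hs)
      _ ≤ √C := by
        refine Real.le_sqrt_of_sq_le (le_trans ?_ hW)
        nlinarith [sq_nonneg (c * Y - s * X)]
  linarith

end Vector

/-! ### The three regimes of the bound. -/

/-- `C` is the largest of the three constants. The last two agree when `(1 - α)² = 4/7`, the first
two when `α = (1 - α) / 2`, that is `α = 1/3`. -/
theorem pvmBound_ge {α : ℝ} (hα0 : 0 ≤ α) (hα1 : α ≤ 1) :
    ∃ C : ℝ, 2 * ((α + (1 - α) / 2) ^ 2 + ((1 - α) / 2) ^ 2) ≤ C ∧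
      (α + 2 * ((1 - α) / 2)) ^ 2 + ((1 - α) / 2) ^ 2 ≤ C ∧
      8 * ((1 - α) / 2) ^ 2 ≤ C ∧ pvmBound α = 1 / 2 + 1 / 4 * √C := by
  have h7 : (2 / √7) ^ 2 = 4 / 7 := by
    rw [div_pow, Real.sq_sqrt (by norm_num)]; norm_num
  have h7' : 0 ≤ 2 / √7 := by positivity
  have h7l : 2 / 3 ≤ 2 / √7 := by
    by_contra hlt
    push Not at hlt
    nlinarith
  unfold pvmBound
  split_ifs with hA hB
  · have hu : 4 / 7 ≤ (1 - α) ^ 2 := by nlinarith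
    refine ⟨8 * ((1 - α) / 2) ^ 2, by nlinarith, by nlinarith, le_rfl, ?_⟩
    have : √(8 * ((1 - α) / 2) ^ 2) = √2 * (1 - α) := by
      rw [show 8 * ((1 - α) / 2) ^ 2 = 2 * (1 - α) ^ 2 by ring, Real.sqrt_mul (by norm_num),
        Real.sqrt_sq (by linarith)]
    rw [this]
    have h2 : √2 ^ 2 = 2 := Real.sq_sqrt (by norm_num)
    field_simp
    nlinarith
  · push Not at hA
    have hu : (1 - α) ^ 2 ≤ 4 / 7 := by nlinarith
    refine ⟨1 + ((1 - α) / 2) ^ 2, by nlinarith, by nlinarith, by nlinarith, ?_⟩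
    rw [show 4 + (1 - α) ^ 2 = 2 ^ 2 * (1 + ((1 - α) / 2) ^ 2) by ring,
      Real.sqrt_mul (by norm_num), Real.sqrt_sq (by norm_num)]
    ring
  · push Not at hA hB
    exact ⟨1 + α ^ 2, by nlinarith, by nlinarith, by nlinarith, rfl⟩

/-! ### Bloch representation of states, effects and instruments. -/

section Bloch

local notation "⟪" u ", " v "⟫" => inner ℝ u v

/-- The space of Bloch vectors. -/
abbrev BlochSpace : Type := EuclideanSpace ℝ (Fin 3)

/-- The components `re tr (σᵢ X)` along the Pauli matrices. -/
noncomputable def bloch : Op →ₗ[ℝ] BlochSpace where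
  toFun X := !₂[(X 0 1).re + (X 1 0).re, (X 1 0).im - (X 0 1).im, (X 0 0).re - (X 1 1).re]
  map_add' X Y := by
    ext i
    fin_cases i <;> simp <;> ring
  map_smul' r X := by
    ext i
    fin_cases i <;> simp <;> ring

/-- The combination of the Pauli matrices with given coefficients. -/
noncomputable def pauli : BlochSpace →ₗ[ℝ] Op where
  toFun v := !![(⟨v 2, 0⟩ : ℂ), ⟨v 0, -v 1⟩; ⟨v 0, v 1⟩, ⟨-v 2, 0⟩]
  map_add' v w := by
    ext i j
    fin_cases i <;> fin_cases j <;> apply Complex.ext <;> simp <;> ring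
  map_smul' r v := by
    ext i j
    fin_cases i <;> fin_cases j <;> apply Complex.ext <;> simp

theorem bloch_apply (X : Op) : bloch X =
    !₂[(X 0 1).re + (X 1 0).re, (X 1 0).im - (X 0 1).im, (X 0 0).re - (X 1 1).re] := rfl

theorem pauli_apply (v : BlochSpace) :
    pauli v = !![(⟨v 2, 0⟩ : ℂ), ⟨v 0, -v 1⟩; ⟨v 0, v 1⟩, ⟨-v 2, 0⟩] := rfl

theorem bloch_one : bloch 1 = 0 := by
  ext i
  fin_cases i <;> simp [bloch_apply]

theorem inner_blochSpace (v w : BlochSpace) : ⟪v, w⟫ = v 0 * w 0 + v 1 * w 1 + v 2 * w 2 := by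
  simp [PiLp.inner_apply, Fin.sum_univ_three]
  ring

theorem norm_sq_blochSpace (v : BlochSpace) : ‖v‖ ^ 2 = v 0 ^ 2 + v 1 ^ 2 + v 2 ^ 2 := by
  rw [← real_inner_self_eq_norm_sq, inner_blochSpace]
  ring

theorem im_diag_eq_zero {A : Op} (hA : A.IsHermitian) (i : Fin 2) : (A i i).im = 0 := by
  have h := congrArg Complex.im (hA.apply i i)
  simp at h
  linarith

theorem re_offDiag {A : Op} (hA : A.IsHermitian) : (A 1 0).re = (A 0 1).re := by
  have h := congrArg Complex.re (hA.apply 0 1)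
  simpa using h

theorem im_offDiag {A : Op} (hA : A.IsHermitian) : (A 1 0).im = -(A 0 1).im := by
  have h := congrArg Complex.im (hA.apply 0 1)
  simp at h
  linarith

theorem re_trace_mul (A : Op) {B : Op} (hB : B.IsHermitian) :
    (A * B).trace.re = (A.trace.re * B.trace.re + ⟪bloch A, bloch B⟫) / 2 := by
  have h0 := im_diag_eq_zero hB 0
  have h1 := im_diag_eq_zero hB 1
  have h2 := re_offDiag hB
  have h3 := im_offDiag hB
  rw [inner_blochSpace]
  simp [bloch_apply, Matrix.trace_fin_two, Matrix.mul_apply, Fin.sum_univ_two, h0, h1, h2, h3]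
  ring

/-- For a projection this forces trace 1 or a vanishing Bloch vector. -/
theorem bloch_mul_self {A : Op} (hA : A.IsHermitian) :
    bloch (A * A) = A.trace.re • bloch A := by
  have h0 := im_diag_eq_zero hA 0
  have h1 := im_diag_eq_zero hA 1
  have h2 := re_offDiag hA
  have h3 := im_offDiag hA
  ext i
  fin_cases i <;>
    simp [bloch_apply, Matrix.trace_fin_two, Matrix.mul_apply, Fin.sum_univ_two, h0, h1, h2, h3] <;>
    ring

/-- For Hermitian `A`, `(tr A)² - ‖bloch A‖² = 4 det A`. -/
theorem norm_bloch_le {A : Op} (hA : A.PosSemidef) : ‖bloch A‖ ≤ A.trace.re := by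
  have h0 := im_diag_eq_zero hA.isHermitian 0
  have h1 := im_diag_eq_zero hA.isHermitian 1
  have h2 := re_offDiag hA.isHermitian
  have h3 := im_offDiag hA.isHermitian
  have ht : 0 ≤ A.trace.re := (Complex.le_def.1 hA.trace_nonneg).1
  have hd : 0 ≤ A.det.re := (Complex.le_def.1 hA.det_nonneg).1
  refine le_of_sq_le_sq ?_ ht
  rw [norm_sq_blochSpace]
  rw [Matrix.det_fin_two] at hd
  simp [bloch_apply, Matrix.trace_fin_two, h0, h1, h2, h3] at hd ⊢
  nlinarith

theorem re_trace_mul_nonneg {A B : Op} (hA : A.PosSemidef) (hB : B.PosSemidef) :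
    0 ≤ (A * B).trace.re := by
  rw [re_trace_mul A hB.isHermitian]
  have h := neg_le_of_abs_le ((abs_real_inner_le_norm (bloch A) (bloch B)).trans
    (mul_le_mul (norm_bloch_le hA) (norm_bloch_le hB) (norm_nonneg _)
      ((norm_nonneg _).trans (norm_bloch_le hA))))
  linarith

/-- The operator with Bloch vector `v` and unit trace. -/
noncomputable def blochState (v : BlochSpace) : Op := (1 / 2 : ℝ) • (1 + pauli v)

theorem isState_blochState {v : BlochSpace} (hv : ‖v‖ = 1) : IsState (blochState v) := by
  have hsq := norm_sq_blochSpace v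
  rw [hv] at hsq
  have hH : (blochState v).conjTranspose = blochState v := by
    ext i j
    fin_cases i <;> fin_cases j <;> apply Complex.ext <;>
      simp [blochState, pauli_apply, Matrix.conjTranspose_apply]
  have hP : (blochState v).conjTranspose * blochState v = blochState v := by
    rw [hH]
    ext i j
    fin_cases i <;> fin_cases j <;> apply Complex.ext <;>
      simp [blochState, pauli_apply, Matrix.mul_apply, Fin.sum_univ_two] <;> nlinarith
  refine ⟨hP ▸ Matrix.posSemidef_conjTranspose_mul_self _, ?_⟩
  apply Complex.ext <;> simp [blochState, pauli_apply, Matrix.trace_fin_two]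

theorem IsState.eq_blochState {ρ : Op} (hρ : IsState ρ) : ρ = blochState (bloch ρ) := by
  have h0 := im_diag_eq_zero hρ.1.isHermitian 0
  have h1 := im_diag_eq_zero hρ.1.isHermitian 1
  have h2 := re_offDiag hρ.1.isHermitian
  have h3 := im_offDiag hρ.1.isHermitian
  have ht := congrArg Complex.re hρ.2
  simp [Matrix.trace_fin_two] at ht
  ext i j
  fin_cases i <;> fin_cases j <;> apply Complex.ext <;>
    simp [blochState, pauli_apply, bloch_apply, h0, h1, h2, h3] <;> linarith

theorem IsState.norm_bloch_le {ρ : Op} (hρ : IsState ρ) : ‖bloch ρ‖ ≤ 1 := by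
  simpa [hρ.2] using QubitPTM.norm_bloch_le hρ.1

theorem bloch_blochState (v : BlochSpace) : bloch (blochState v) = v := by
  ext i
  fin_cases i <;> simp [bloch_apply, blochState, pauli_apply] <;> ring

theorem IsCP.posSemidef {Φ : Op →ₗ[ℂ] Op} (hΦ : IsCP Φ) {X : Op} (hX : X.PosSemidef) :
    (Φ X).PosSemidef := by
  -- A one-dimensional ancilla turns complete positivity into positivity.
  have h := hΦ 1 (X.submatrix Prod.snd Prod.snd) (hX.submatrix _)
  exact h.submatrix fun a : Fin 2 => ((0 : Fin 1), a)

theorem IsInstrument.posSemidef_add {I : Fin 2 → Op →ₗ[ℂ] Op} (hI : IsInstrument I) {X : Op}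
    (hX : X.PosSemidef) : ((I 0 + I 1) X).PosSemidef :=
  ((hI.1 0).posSemidef hX).add ((hI.1 1).posSemidef hX)

/-- The linear part of the action of a map on Bloch vectors. -/
noncomputable def blochMap (Φ : Op →ₗ[ℂ] Op) : BlochSpace →ₗ[ℝ] BlochSpace :=
  (1 / 2 : ℝ) • (bloch ∘ₗ Φ.restrictScalars ℝ ∘ₗ pauli)

theorem blochMap_apply (Φ : Op →ₗ[ℂ] Op) (v : BlochSpace) :
    blochMap Φ v = (1 / 2 : ℝ) • bloch (Φ (pauli v)) := rfl

theorem map_blochState (Φ : Op →ₗ[ℂ] Op) (v : BlochSpace) :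
    Φ (blochState v) = (1 / 2 : ℝ) • Φ 1 + (1 / 2 : ℝ) • Φ (pauli v) := by
  rw [blochState, smul_add, map_add, LinearMap.map_smul_of_tower, LinearMap.map_smul_of_tower]

theorem bloch_map_blochState (Φ : Op →ₗ[ℂ] Op) (v : BlochSpace) :
    bloch (Φ (blochState v)) = (1 / 2 : ℝ) • bloch (Φ 1) + blochMap Φ v := by
  rw [map_blochState, map_add, map_smul, map_smul, blochMap_apply]

theorem norm_map_le_of_unit {f : BlochSpace →ₗ[ℝ] BlochSpace} (v : BlochSpace)
    (hf : ∀ v, ‖v‖ = 1 → ‖f v‖ ≤ 1) : ‖f v‖ ≤ ‖v‖ := by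
  by_cases h : v = 0
  · simp [h]
  · have h1 := hf _ (norm_smul_inv_norm (𝕜 := ℝ) h)
    simp only [RCLike.ofReal_real_eq_id, id] at h1
    rwa [map_smul, norm_smul, norm_inv, norm_norm, inv_mul_le_one₀ (norm_pos_iff.2 h)] at h1

/-- The channel need not be unital, but its translation part cancels between the antipodal states
`v` and `-v`. -/
theorem norm_blochMap_le {I : Fin 2 → Op →ₗ[ℂ] Op} (hI : IsInstrument I) (v : BlochSpace) :
    ‖blochMap (I 0 + I 1) v‖ ≤ ‖v‖ := by
  refine norm_map_le_of_unit v fun v hv => ?_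
  have hst : ∀ w : BlochSpace, ‖w‖ = 1 → ‖bloch ((I 0 + I 1) (blochState w))‖ ≤ 1 := fun w hw => by
    have h := norm_bloch_le (hI.posSemidef_add (isState_blochState hw).1)
    rwa [LinearMap.add_apply, hI.2, (isState_blochState hw).2, Complex.one_re] at h
  have h2 : (2 : ℝ) • blochMap (I 0 + I 1) v =
      bloch ((I 0 + I 1) (blochState v)) - bloch ((I 0 + I 1) (blochState (-v))) := by
    rw [bloch_map_blochState, bloch_map_blochState, map_neg]
    module
  have h3 := norm_sub_le (bloch ((I 0 + I 1) (blochState v)))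
    (bloch ((I 0 + I 1) (blochState (-v))))
  rw [← h2, norm_smul, Real.norm_eq_abs, abs_two] at h3
  linarith [hst v hv, hst (-v) (by rwa [norm_neg])]

/-- The states `±s v - c n` lie near `-n`, where the output is `O(s²)`, while the outputs differ by
`2 s` times the image of `v`. Letting `s → 0` kills that image. -/
theorem blochMap_eq_zero_of_orthogonal {Φ : Op →ₗ[ℂ] Op} {n v : BlochSpace} (hn : ‖n‖ = 1)
    (hΦ : ∀ w, ‖w‖ = 1 → ‖bloch (Φ (blochState w))‖ ≤ (1 + ⟪w, n⟫) / 2) (hvn : ⟪v, n⟫ = 0) :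
    blochMap Φ v = 0 := by
  wlog hv : ‖v‖ = 1 generalizing v
  · by_cases h : v = 0
    · simp [h]
    · have h1 := this (v := ‖v‖⁻¹ • v) (by rw [inner_smul_left, hvn, mul_zero])
        (norm_smul_inv_norm h)
      rw [map_smul] at h1
      exact (smul_eq_zero.1 h1).resolve_left (inv_ne_zero (norm_ne_zero_iff.2 h))
  rw [← norm_le_zero_iff]
  refine le_of_forall_pos_le_add fun ε hε => ?_
  rw [zero_add]
  set s := min ε 1
  have hs : 0 < s := lt_min hε one_pos
  have hs1 : s ≤ 1 := min_le_right _ _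
  refine le_trans ?_ (min_le_left ε 1)
  have hs2 : 0 ≤ 1 - s ^ 2 := by nlinarith
  set c := √(1 - s ^ 2)
  have hc : 0 ≤ c := Real.sqrt_nonneg _
  have hc2 : c ^ 2 = 1 - s ^ 2 := Real.sq_sqrt hs2
  have hunit : ∀ t : ℝ, t ^ 2 = s ^ 2 → ‖t • v - c • n‖ = 1 := fun t ht => by
    have : ‖t • v - c • n‖ ^ 2 = 1 := by
      rw [norm_sub_sq_real, inner_smul_left, inner_smul_right, hvn, norm_smul, norm_smul, hv, hn]
      simp only [mul_one, mul_zero, Real.norm_eq_abs, sq_abs, ht, hc2]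
      ring
    nlinarith [norm_nonneg (t • v - c • n)]
  have hin : ∀ t : ℝ, ⟪t • v - c • n, n⟫ = -c := fun t => by
    rw [inner_sub_left, inner_smul_left, inner_smul_left, hvn, real_inner_self_eq_norm_sq, hn]
    simp
  have hp := hΦ _ (hunit s rfl)
  have hm := hΦ _ (hunit (-s) (neg_sq s))
  rw [hin] at hp hm
  have hdiff : (2 * s) • blochMap Φ v =
      bloch (Φ (blochState (s • v - c • n))) - bloch (Φ (blochState ((-s) • v - c • n))) := by
    rw [bloch_map_blochState, bloch_map_blochState, map_sub, map_sub, map_smul, map_smul, map_smul]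
    module
  have h3 := norm_sub_le (bloch (Φ (blochState (s • v - c • n))))
    (bloch (Φ (blochState ((-s) • v - c • n))))
  rw [← hdiff, norm_smul, Real.norm_eq_abs, abs_of_pos (by positivity)] at h3
  -- Uses `1 - c ≤ 1 - c² = s²`, valid as `0 ≤ c ≤ 1`.
  have h4 : 2 * (s * ‖blochMap Φ v‖) ≤ s * s := by nlinarith
  have h5 : s * ‖blochMap Φ v‖ ≤ s * s := by nlinarith [norm_nonneg (blochMap Φ v)]
  exact le_of_mul_le_mul_left h5 hs

theorem IsPVM.bloch_eq_zero_or {E : Fin 2 → Op} (hE : IsPVM E) :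
    bloch (E 0) = 0 ∨ ((E 0).trace.re = 1 ∧ ‖bloch (E 0)‖ = 1) := by
  have hH := (hE.1.1 0).isHermitian
  have h1 := bloch_mul_self hH
  have h2 := re_trace_mul (E 0) hH
  rw [hE.2 0] at h1 h2
  have h3 : ((E 0).trace.re - 1) • bloch (E 0) = 0 := by
    rw [sub_smul, one_smul, ← h1, sub_self]
  rcases smul_eq_zero.1 h3 with h | h
  · right
    have ht : (E 0).trace.re = 1 := by linarith
    rw [ht, real_inner_self_eq_norm_sq] at h2
    exact ⟨ht, by nlinarith [norm_nonneg (bloch (E 0))]⟩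
  · exact Or.inl h

theorem IsPOVM.bloch_one_eq {E : Fin 2 → Op} (hE : IsPOVM E) : bloch (E 1) = -bloch (E 0) := by
  have h := congrArg bloch hE.2
  rw [map_add, bloch_one] at h
  exact (neg_eq_of_add_eq_zero_right h).symm

theorem IsPOVM.re_trace_one_eq {E : Fin 2 → Op} (hE : IsPOVM E) :
    (E 1).trace.re = 2 - (E 0).trace.re := by
  have h := congrArg (fun X : Op => X.trace.re) hE.2
  simp at h
  linarith

theorem IsPOVM.norm_bloch_le {E : Fin 2 → Op} (hE : IsPOVM E) : ‖bloch (E 0)‖ ≤ 1 := by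
  have h0 := QubitPTM.norm_bloch_le (hE.1 0)
  have h1 := QubitPTM.norm_bloch_le (hE.1 1)
  rw [hE.bloch_one_eq, hE.re_trace_one_eq, norm_neg] at h1
  linarith

/-- The sign `(-1)^b`. -/
def bitSign (b : Fin 2) : ℝ := if b = 0 then 1 else -1

theorem IsPOVM.re_trace_mul_eq {E : Fin 2 → Op} (hE : IsPOVM E) {X : Op} (hX : X.trace.re = 1)
    (b : Fin 2) : (X * E b).trace.re =
      1 / 2 + bitSign b / 2 * ((E 0).trace.re - 1 + ⟪bloch (E 0), bloch X⟫) := by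
  rw [re_trace_mul X (hE.1 b).isHermitian, hX, real_inner_comm]
  fin_cases b
  · simp [bitSign]
    ring
  · simp [bitSign, hE.bloch_one_eq, hE.re_trace_one_eq]
    ring

theorem isBlochProjective_of_compatible {I : Fin 2 → Op →ₗ[ℂ] Op} {E : Fin 2 → Op}
    (hI : IsInstrument I) (hE : IsPVM E) (hIE : Compatible I E) :
    IsBlochProjective (bloch (E 0)) (blochMap (I 0 + I 1)) := by
  rcases hE.bloch_eq_zero_or with h | ⟨ht, hn⟩
  · exact Or.inr ⟨h, norm_blochMap_le hI⟩
  refine Or.inl ⟨hn.le, blochMap (I 0 + I 1) (bloch (E 0)),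
    (norm_blochMap_le hI _).trans hn.le, fun v => ?_⟩
  have hb : ∀ b w, ‖w‖ = 1 → ‖bloch (I b (blochState w))‖ ≤
      (1 + ⟪w, bitSign b • bloch (E 0)⟫) / 2 := fun b w hw => by
    have hst := isState_blochState hw
    have h := norm_bloch_le ((hI.1 b).posSemidef hst.1)
    rw [← hIE _ hst b, hE.1.re_trace_mul_eq (by rw [hst.2, Complex.one_re]) b, ht,
      bloch_blochState] at h
    rw [inner_smul_right, real_inner_comm]
    linarith
  have hz : ∀ u, ⟪u, bloch (E 0)⟫ = 0 → blochMap (I 0 + I 1) u = 0 := fun u hu => by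
    have h : ∀ b, blochMap (I b) u = 0 := fun b =>
      blochMap_eq_zero_of_orthogonal (n := bitSign b • bloch (E 0))
        (by fin_cases b <;> simp [bitSign, hn]) (hb b) (by rw [inner_smul_right, hu, mul_zero])
    have := congrArg₂ (· + ·) (h 0) (h 1)
    simpa [blochMap_apply] using this
  -- Only the component of `v` along the unit vector `bloch (E 0)` survives.
  have h0 := hz (v - ⟪bloch (E 0), v⟫ • bloch (E 0)) (by
    rw [inner_sub_left, inner_smul_left, real_inner_self_eq_norm_sq, hn, real_inner_comm]
    simp)
  rw [map_sub, map_smul, sub_eq_zero] at h0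
  exact h0

end Bloch

/-! ### From Bloch vectors to the score, mixtures and shared randomness. -/

section Score

local notation "⟪" u ", " v "⟫" => inner ℝ u v

theorem IsInstrument.re_trace_add {I : Fin 2 → Op →ₗ[ℂ] Op} (hI : IsInstrument I) {ρ : Op}
    (hρ : IsState ρ) : (I 0 ρ + I 1 ρ).trace.re = 1 := by
  rw [hI.2, hρ.2, Complex.one_re]

theorem Strategy.prob_nonneg (S : Strategy) (b c : Fin 2) (x : Fin 2 → Fin 2) (y z : Fin 2) :
    0 ≤ S.prob b c x y z :=
  re_trace_mul_nonneg (((S.instr y).1 b).posSemidef (S.state x).1) ((S.povm z).1 c)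

theorem Strategy.sum_prob_charlie (S : Strategy) (b : Fin 2) (x : Fin 2 → Fin 2) (y z : Fin 2) :
    S.prob b 0 x y z + S.prob b 1 x y z = (S.B y b (S.ρ x)).trace.re := by
  rw [Strategy.prob, Strategy.prob, ← Complex.add_re, ← Matrix.trace_add, ← mul_add,
    (S.povm z).2, mul_one]

theorem Strategy.sum_prob_bob (S : Strategy) (c : Fin 2) (x : Fin 2 → Fin 2) (y z : Fin 2) :
    S.prob 0 c x y z + S.prob 1 c x y z =
      1 / 2 + bitSign c / 2 * ((S.C z 0).trace.re - 1 +
        (⟪bloch (S.C z 0), (1 / 2 : ℝ) • bloch ((S.B y 0 + S.B y 1) 1)⟫ +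
          ⟪bloch (S.C z 0), blochMap (S.B y 0 + S.B y 1) (bloch (S.ρ x))⟫)) := by
  rw [Strategy.prob, Strategy.prob, ← Complex.add_re, ← Matrix.trace_add, ← add_mul,
    (S.povm z).re_trace_mul_eq ((S.instr y).re_trace_add (S.state x)), ← inner_add_right,
    ← bloch_map_blochState, ← (S.state x).eq_blochState, LinearMap.add_apply]

theorem Strategy.prob_le_one (S : Strategy) (b c : Fin 2) (x : Fin 2 → Fin 2) (y z : Fin 2) :
    S.prob b c x y z ≤ 1 := by
  have h0 := S.sum_prob_charlie 0 x y z
  have h1 := S.sum_prob_charlie 1 x y z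
  have h2 : (S.B y 0 (S.ρ x)).trace.re + (S.B y 1 (S.ρ x)).trace.re = 1 := by
    rw [← Complex.add_re, ← Matrix.trace_add, (S.instr y).re_trace_add (S.state x)]
  have h := fun b c => S.prob_nonneg b c x y z
  have := h 0 0
  have := h 0 1
  have := h 1 0
  have := h 1 1
  fin_cases b <;> fin_cases c <;> simp only [Fin.zero_eta, Fin.mk_one] <;> linarith

theorem sum_two_bits (f : (Fin 2 → Fin 2) → ℝ) :
    ∑ x, f x = f ![0, 0] + f ![0, 1] + f ![1, 0] + f ![1, 1] := by
  rw [← (finTwoArrowEquiv (Fin 2)).symm.sum_comp, Fintype.sum_prod_type]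
  simp only [Fin.sum_univ_two, finTwoArrowEquiv_symm_apply]
  ring

/-- Each bit of `x` is balanced, so the terms independent of `x`, including the channels'
translations, cancel. What remains beyond `1/2` is `1/16` of the expression in `bloch_score_le`,
with `a = r₀₀ - r₁₁` and `b = r₀₁ - r₁₀`. -/
theorem Strategy.successProb_le_of_projective {α : ℝ} (hα0 : 0 ≤ α) (hα1 : α ≤ 1) (S : Strategy)
    (hS : ∀ y, S.B y ∈ pvmInstruments) : successProb α S.prob ≤ pvmBound α := by
  choose _ E hE hSE using hS
  obtain ⟨C, c₁, c₂, c₃, hC⟩ := pvmBound_ge hα0 hα1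
  have hproj := fun y => isBlochProjective_of_compatible (S.instr y) (hE y) (hSE y)
  have hr := fun x => (S.state x).norm_bloch_le
  have hdiff : ∀ x x', ‖bloch (S.ρ x) - bloch (S.ρ x')‖ ≤ 2 := fun x x' =>
    (norm_sub_le _ _).trans (by linarith [hr x, hr x'])
  have key := bloch_score_le hα0 (by linarith : 0 ≤ (1 - α) / 2) (hproj 0) (hproj 1)
    (S.povm 0).norm_bloch_le (S.povm 1).norm_bloch_le
    (hdiff ![0, 0] ![1, 1]) (hdiff ![0, 1] ![1, 0]) c₁ c₂ c₃
  have hbob : ∀ x y b, bobProb S.prob b x y = 1 / 2 + bitSign b / 2 *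
      ((E y 0).trace.re - 1 + ⟪bloch (E y 0), bloch (S.ρ x)⟫) := fun x y b => by
    simp only [bobProb, Fin.sum_univ_two, Strategy.sum_prob_charlie]
    rw [← hSE y _ (S.state x) b,
      (hE y).1.re_trace_mul_eq (by rw [(S.state x).2, Complex.one_re])]
    ring
  have hcharlie : ∀ x z c, charlieProb S.prob c x z = (1 / 2) * ∑ y : Fin 2,
      (1 / 2 + bitSign c / 2 * ((S.C z 0).trace.re - 1 +
        (⟪bloch (S.C z 0), (1 / 2 : ℝ) • bloch ((S.B y 0 + S.B y 1) 1)⟫ +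
          ⟪bloch (S.C z 0), blochMap (S.B y 0 + S.B y 1) (bloch (S.ρ x))⟫))) := fun x z c => by
    simp only [charlieProb, Fin.sum_univ_two, Strategy.sum_prob_bob]
  rw [hC]
  simp only [successProb, hbob, hcharlie, sum_two_bits, Fin.sum_univ_two, Matrix.cons_val_zero,
    Matrix.cons_val_one, bitSign, if_true, one_ne_zero, if_false]
  simp only [inner_add_right, inner_sub_right, map_add, map_sub, LinearMap.add_apply] at key ⊢
  linarith

theorem successProb_add (α : ℝ) (p q : Fin 2 → Fin 2 → (Fin 2 → Fin 2) → Fin 2 → Fin 2 → ℝ) :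
    successProb α (p + q) = successProb α p + successProb α q := by
  simp only [successProb, bobProb, charlieProb, Pi.add_apply, Finset.sum_add_distrib, mul_add]
  ring

theorem successProb_smul (α r : ℝ)
    (p : Fin 2 → Fin 2 → (Fin 2 → Fin 2) → Fin 2 → Fin 2 → ℝ) :
    successProb α (r • p) = r * successProb α p := by
  simp only [successProb, bobProb, charlieProb, Pi.smul_apply, smul_eq_mul, ← Finset.mul_sum,
    mul_left_comm _ r]
  ring

theorem Strategy.successProb_le {α : ℝ} (hα0 : 0 ≤ α) (hα1 : α ≤ 1) (S : Strategy)
    (hS : ∀ y, S.B y ∈ pvmMixtures) : successProb α S.prob ≤ pvmBound α := by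
  let p : (Fin 2 → Fin 2 → Op →ₗ[ℂ] Op) →
      Fin 2 → Fin 2 → (Fin 2 → Fin 2) → Fin 2 → Fin 2 → ℝ :=
    fun B b c x y z => (B y b (S.ρ x) * S.C z c).trace.re
  have hadd : ∀ B B', p (B + B') = p B + p B' := fun B B' => by
    funext b c x y z
    simp only [p, Pi.add_apply, LinearMap.add_apply, add_mul, Matrix.trace_add, Complex.add_re]
  have hsmul : ∀ (r : ℝ) B, p (r • B) = r • p B := fun r B => by
    funext b c x y z
    simp only [p, Pi.smul_apply, LinearMap.smul_apply, Matrix.smul_mul, Matrix.trace_smul,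
      Complex.smul_re]
  have hf : IsLinearMap ℝ fun B => successProb α (p B) :=
    ⟨fun B B' => by rw [hadd, successProb_add],
      fun r B => by rw [hsmul, successProb_smul, smul_eq_mul]⟩
  -- The hull of a product is the product of the hulls, so both instruments decompose at once and
  -- the linear score is bounded on a half-space.
  have hmem : S.B ∈ convexHull ℝ (Set.univ.pi fun _ : Fin 2 => pvmInstruments) := by
    rw [convexHull_pi]
    exact fun y _ => hS y
  refine convexHull_min (t := {B | successProb α (p B) ≤ pvmBound α}) (fun B hB => ?_)
    (convex_halfSpace_le hf _) hmem
  exact Strategy.successProb_le_of_projective hα0 hα1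
    ⟨S.ρ, B, S.C, S.state, fun y => (hB y trivial).1, S.povm⟩ fun y => hB y trivial

theorem successProb_observedProb (α : ℝ) {Ω : Type*} [MeasurableSpace Ω] (μ : Measure Ω)
    (S : Ω → Strategy) (hS : ∀ b c x y z, Integrable (fun ω => (S ω).prob b c x y z) μ) :
    Integrable (fun ω => successProb α (S ω).prob) μ ∧
      successProb α (observedProb μ S) = ∫ ω, successProb α (S ω).prob ∂μ := by
  have hb : ∀ b x y, Integrable (fun ω => bobProb (S ω).prob b x y) μ := fun b x y =>
    (integrable_finsetSum _ fun z _ => integrable_finsetSum _ fun c _ =>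
      hS b c x y z).const_mul _
  have hc : ∀ c x z, Integrable (fun ω => charlieProb (S ω).prob c x z) μ := fun c x z =>
    (integrable_finsetSum _ fun y _ => integrable_finsetSum _ fun b _ =>
      hS b c x y z).const_mul _
  have hb' : ∀ b x y, bobProb (observedProb μ S) b x y = ∫ ω, bobProb (S ω).prob b x y ∂μ :=
    fun b x y => by
      simp only [bobProb, observedProb]
      rw [integral_const_mul, integral_finsetSum _ fun z _ => integrable_finsetSum _ fun c _ =>
        hS b c x y z]
      simp_rw [integral_finsetSum _ fun c _ => hS b c x y _]
  have hc' : ∀ c x z, charlieProb (observedProb μ S) c x z =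
      ∫ ω, charlieProb (S ω).prob c x z ∂μ := fun c x z => by
    simp only [charlieProb, observedProb]
    rw [integral_const_mul, integral_finsetSum _ fun y _ => integrable_finsetSum _ fun b _ =>
      hS b c x y z]
    simp_rw [integral_finsetSum _ fun b _ => hS b c x _ z]
  have hB : Integrable (fun ω => ∑ x : Fin 2 → Fin 2, ∑ y, bobProb (S ω).prob (x y) x y) μ :=
    integrable_finsetSum _ fun x _ => integrable_finsetSum _ fun y _ => hb _ _ _
  have hC : Integrable (fun ω => ∑ x : Fin 2 → Fin 2, ∑ z, charlieProb (S ω).prob (x z) x z) μ :=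
    integrable_finsetSum _ fun x _ => integrable_finsetSum _ fun z _ => hc _ _ _
  refine ⟨(hB.const_mul _).add (hC.const_mul _), ?_⟩
  simp only [successProb, hb', hc']
  rw [integral_add (hB.const_mul _) (hC.const_mul _), integral_const_mul, integral_const_mul,
    integral_finsetSum _ fun x _ => integrable_finsetSum _ fun y _ => hb _ _ _,
    integral_finsetSum _ fun x _ => integrable_finsetSum _ fun z _ => hc _ _ _]
  simp_rw [integral_finsetSum _ fun y _ => hb _ _ y, integral_finsetSum _ fun z _ => hc _ _ z]

end Score

end QubitPTM

theorem proposition1 (α : ℝ) (hα0 : 0 ≤ α) (hα1 : α ≤ 1)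
    {Ω : Type*} [MeasurableSpace Ω] (μ : Measure Ω) [IsProbabilityMeasure μ]
    (S : Ω → QubitPTM.Strategy)
    (hmeas : ∀ b c x y z, AEMeasurable (fun ω => (S ω).prob b c x y z) μ)
    (hS : ∀ ω y, (S ω).B y ∈ QubitPTM.pvmMixtures) :
    QubitPTM.successProb α (QubitPTM.observedProb μ S) ≤ QubitPTM.pvmBound α := by
  have hint : ∀ b c x y z, Integrable (fun ω => (S ω).prob b c x y z) μ := fun b c x y z =>
    Integrable.of_bound (hmeas b c x y z).aestronglyMeasurable 1 (Filter.Eventually.of_forall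
      fun ω => by
        rw [Real.norm_eq_abs, abs_of_nonneg ((S ω).prob_nonneg b c x y z)]
        exact (S ω).prob_le_one b c x y z)
  obtain ⟨hi, heq⟩ := QubitPTM.successProb_observedProb α μ S hint
  rw [heq]
  calc _ ≤ ∫ _, QubitPTM.pvmBound α ∂μ :=
        integral_mono hi (integrable_const _) fun ω => (S ω).successProb_le hα0 hα1 (hS ω)
    _ = QubitPTM.pvmBound α := by simp
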